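/- A differential ring is a commutative ring with identity equipped with a finite set $\Delta$ of pairwise commuting derivations; $\Delta$ is the same for all rings considered. A differential ideal is an ideal stable under every $\delta\in\Delta$; differential homomorphisms are ring homomorphisms commuting with every $\delta\in\Delta$. A Ritt algebra is a differential ring that is a $\mathbb{Q}$-algebra. For a differential ring $B$ and $s\in B$, the localization $B_s=B[1/s]$ carries the unique derivations extending those of $B$. A differential homomorphism $f\colon A\to B$ has the going-down property for differential ideals if for every $1\le m<n$, every chain $\mathfrak p_1\supseteq\cdots\supseteq\mathfrak p_n$ of prime differential ideals of $f(A)$ and every chain $\mathfrak q_1\supseteq\cdots\supseteq\mathfrak q_m$ of prime differential ideals of $B$ with $\mathfrak q_i\cap f(A)=\mathfrak p_i$ for $1\le i\le m$, there are prime differential ideals $\mathfrak q_{m+1},\dots,\mathfrak q_n$ of $B$ such that $\mathfrak q_1\supseteq\cdots\supseteq\mathfrak q_n$ and $\mathfrak q_i\cap f(A)=\mathfrak p_i$ for $1\le i\le n$. Theorem. Let $A\subseteq B$ be Ritt algebras, $A$ a differential subring of $B$, and suppose that $B$ is an integral domain which is differentially finitely generated over $A$ (that is, some finite subset of $B$ is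 contained in no proper differential $A$-subalgebra of $B$). Then there is a nonzero element $s\in B$ such that the natural map $A\to B_s$ is injective and has the going-down property for differential ideals. -/

import Mathlib

/-- A differential ring: a commutative ring with pairwise commuting derivations
indexed by `Δ` (the theorem takes `Δ` to be finite). -/
class DiffRing (Δ : Type*) (R : Type*) [CommRing R] where
  /-- the derivation attached to an index -/
  deriv : Δ → Derivation ℤ R R
  deriv_comm : ∀ (i j : Δ) (x : R), deriv i (deriv j x) = deriv j (deriv i x)

namespace DiffRing

/-- A ring homomorphism between differential rings is differential if it commutes with all
derivations. -/
def IsDiffHom (Δ : Type*) {A B : Type*} [CommRing A] [CommRing B] [DiffRing Δ A] [DiffRing Δ B]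
    (f : A →+* B) : Prop :=
  ∀ (i : Δ) (a : A), f (deriv i a) = deriv i (f a)

/-- A differential ideal: an ideal stable under all derivations. -/
def IsDiffIdeal (Δ : Type*) {R : Type*} [CommRing R] [DiffRing Δ R] (I : Ideal R) : Prop :=
  ∀ (i : Δ), ∀ x ∈ I, deriv i x ∈ I

/-- A prime differential ideal. -/
def IsPrimeDiff (Δ : Type*) {R : Type*} [CommRing R] [DiffRing Δ R] (I : Ideal R) : Prop :=
  I.IsPrime ∧ IsDiffIdeal Δ I

/-- `B` is differentially finitely generated over `A`: there is a finite subset of `B` such that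
the only differential `A`-subalgebra of `B` containing it is `B` itself. -/
def DiffFiniteType (Δ : Type*) (A B : Type*) [CommRing A] [CommRing B] [Algebra A B]
    [DiffRing Δ B] : Prop :=
  ∃ t : Finset B, ∀ S : Subalgebra A B,
    (∀ (i : Δ), ∀ x ∈ S, deriv i x ∈ S) → (t : Set B) ⊆ S → S = ⊤

section Range

variable {Δ : Type*} {A B : Type*} [CommRing A] [CommRing B] [DiffRing Δ A] [DiffRing Δ B]

theorem deriv_mem_range {f : A →+* B} (hf : IsDiffHom Δ f) (i : Δ) (x : f.range) :
    deriv i (x : B) ∈ f.range := by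
  obtain ⟨_, a, rfl⟩ := x
  exact ⟨deriv i a, hf i a⟩

/-- The image `f(A)` of a differential homomorphism `f : A → B`, as a differential subring
of `B`. -/
@[reducible]
def range {f : A →+* B} (hf : IsDiffHom Δ f) : DiffRing Δ f.range where
  deriv i := Derivation.mk'
    { toFun := fun x => ⟨deriv i (x : B), deriv_mem_range hf i x⟩
      map_add' := fun x y => Subtype.ext (by simp)
      map_smul' := fun n x => Subtype.ext (by simp) }
    (fun x y => Subtype.ext (by simp))
  deriv_comm i j x := Subtype.ext (deriv_comm i j (x : B))

/-- Going-down for differential ideals, for a differential homomorphism `f : A → B`: for every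
chain `p₁ ⊇ ⋯ ⊇ pₙ` of prime differential ideals in `f(A)` and every nonempty chain
`q₁ ⊇ ⋯ ⊇ qₘ` (`m < n`) of prime differential ideals in `B` with `qᵢ ∩ f(A) = pᵢ` for `i ≤ m`,
the second chain extends to a chain `q₁ ⊇ ⋯ ⊇ qₙ` of prime differential ideals in `B` with
`qᵢ ∩ f(A) = pᵢ` for all `i ≤ n`. -/
def HasDiffGoingDown (f : A →+* B) (hf : IsDiffHom Δ f) : Prop :=
  letI : DiffRing Δ f.range := range hf
  ∀ (n m : ℕ) (_ : 0 < m) (hmn : m < n)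
    (p : Fin n → Ideal f.range) (q : Fin m → Ideal B),
    Antitone p → (∀ k, IsPrimeDiff Δ (p k)) →
    Antitone q → (∀ k, IsPrimeDiff Δ (q k)) →
    (∀ k, (q k).comap f.range.subtype = p (Fin.castLE hmn.le k)) →
    ∃ q' : Fin n → Ideal B,
      Antitone q' ∧ (∀ k, IsPrimeDiff Δ (q' k)) ∧
      (∀ k, q' (Fin.castLE hmn.le k) = q k) ∧
      ∀ k, (q' k).comap f.range.subtype = p k

end Range

section Localization

variable {B : Type*} [CommRing B] (s : B) (L : Type*) [CommRing L] [Algebra B L]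

/-- The ring homomorphism `b ↦ b + D(b) ε` from `B` to the dual numbers over a `B`-algebra `L`. -/
def toDual (D : Derivation ℤ B B) : B →+* TrivSqZeroExt L L where
  toFun b := TrivSqZeroExt.inl (algebraMap B L b) + TrivSqZeroExt.inr (algebraMap B L (D b))
  map_one' := by ext <;> simp
  map_zero' := by ext <;> simp
  map_add' x y := by ext <;> simp [-DualNumber.inr_eq_smul_eps]
  map_mul' x y := by ext <;> simp [-DualNumber.inr_eq_smul_eps, mul_comm]

theorem fst_toDual (D : Derivation ℤ B B) (b : B) : (toDual L D b).fst = algebraMap B L b := by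
  simp [toDual]

theorem snd_toDual (D : Derivation ℤ B B) (b : B) :
    (toDual L D b).snd = algebraMap B L (D b) := by
  simp [toDual, -DualNumber.inr_eq_smul_eps]

variable [IsLocalization.Away s L]

theorem isUnit_toDual (D : Derivation ℤ B B) (y : Submonoid.powers s) :
    IsUnit (toDual L D y) := by
  rw [TrivSqZeroExt.isUnit_iff_isUnit_fst, fst_toDual]
  exact IsLocalization.map_units L y

/-- The extension of `toDual` to the localization `L = B_s`. -/
noncomputable def awayToDual (D : Derivation ℤ B B) : L →+* TrivSqZeroExt L L :=
  IsLocalization.lift (M := Submonoid.powers s) (isUnit_toDual s L D)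

theorem awayToDual_algebraMap (D : Derivation ℤ B B) (b : B) :
    awayToDual s L D (algebraMap B L b) = toDual L D b :=
  IsLocalization.lift_eq _ b

theorem fst_awayToDual (D : Derivation ℤ B B) (x : L) : (awayToDual s L D x).fst = x := by
  have h : ((TrivSqZeroExt.fstHom L L L).toRingHom.comp (awayToDual s L D)) = RingHom.id L := by
    apply IsLocalization.ringHom_ext (Submonoid.powers s)
    ext b
    have := fst_toDual L D b
    rw [← awayToDual_algebraMap s L D b] at this
    exact this
  exact congrArg (fun g => g x) h

/-- The unique extension of a derivation of `B` to the localization `L = B_s`. -/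
noncomputable def awayDeriv (D : Derivation ℤ B B) : Derivation ℤ L L :=
  Derivation.mk'
    ((AddMonoidHom.mk' (fun x => (awayToDual s L D x).snd) (fun x y => by simp)).toIntLinearMap)
    (fun x y => by simp [fst_awayToDual, mul_comm])

theorem awayDeriv_algebraMap (D : Derivation ℤ B B) (b : B) :
    awayDeriv s L D (algebraMap B L b) = algebraMap B L (D b) := by
  change (awayToDual s L D (algebraMap B L b)).snd = _
  rw [awayToDual_algebraMap, snd_toDual]

/-- A derivation of `L = B_s` vanishing on the image of `B` is zero. -/
theorem away_deriv_eq_zero {B : Type*} [CommRing B] (s : B) (L : Type*) [CommRing L]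
    [Algebra B L] [IsLocalization.Away s L] (D : Derivation ℤ L L)
    (h : ∀ b : B, D (algebraMap B L b) = 0) (x : L) : D x = 0 := by
  obtain ⟨⟨b, y⟩, hb⟩ := IsLocalization.surj (Submonoid.powers s) x
  have h1 := congrArg D hb
  simp only [Derivation.leibniz, h, zero_add, smul_eq_mul, mul_zero] at h1
  exact ((IsLocalization.map_units L y).mul_right_eq_zero).1 h1

theorem awayDeriv_comm (D E : Derivation ℤ B B) (hDE : ∀ b, D (E b) = E (D b)) (x : L) :
    awayDeriv s L D (awayDeriv s L E x) = awayDeriv s L E (awayDeriv s L D x) := by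
  have h := away_deriv_eq_zero s L ⁅awayDeriv s L D, awayDeriv s L E⁆
    (fun b => by simp only [Derivation.commutator_apply, awayDeriv_algebraMap, hDE, sub_self]) x
  rw [Derivation.commutator_apply] at h
  exact sub_eq_zero.1 h

variable {Δ : Type*} [DiffRing Δ B]

/-- The localization `B_s = B[1/s]` of a differential ring, with the extended derivations. -/
noncomputable instance away : DiffRing Δ (Localization.Away s) where
  deriv i := awayDeriv s (Localization.Away s) (deriv i)
  deriv_comm i j x := awayDeriv_comm s _ (deriv i) (deriv j) (deriv_comm i j) x

/-- If `A → B` is differential then so is `A → B_s`. -/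
theorem isDiffHom_away {A : Type*} [CommRing A] [DiffRing Δ A] [Algebra A B]
    (h : IsDiffHom Δ (algebraMap A B)) :
    IsDiffHom Δ (algebraMap A (Localization.Away s)) := by
  intro i a
  rw [IsScalarTower.algebraMap_apply A B (Localization.Away s),
    IsScalarTower.algebraMap_apply A B (Localization.Away s), h i a]
  exact (awayDeriv_algebraMap s (Localization.Away s) (deriv i) _).symm

end Localization

end DiffRing

/-!
Rank the derivatives of the differential generators, and let `P` be the subring generated over `A`
by those that are transcendental over the derivatives of lower rank: it is a polynomial ring, hence
free over `A`. If a derivative `v` is algebraic over the lower ones, then differentiating a minimal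
relation of `v` shows that every proper derivative of `v` is a fraction in lower derivatives, with
the separant of that relation as denominator. By Dickson's lemma all but finitely many of the
algebraic derivatives are proper derivatives of finitely many of them. So, up to finitely many
denominators, `B` is algebraic and finitely generated over `P`, and inverting one more element
makes it flat over `A`.

Flatness gives going down for prime ideals. In a Ritt algebra the minimal primes of a differential
ideal are differential, so the prime below can be replaced by a differential one.
-/

open Polynomial

theorem antitone_snoc {α : Type*} [Preorder α] {n : ℕ} {q : Fin (n + 1) → α} (hq : Antitone q)
    {a : α} (ha : a ≤ q (Fin.last n)) : Antitone (Fin.snoc q a : Fin (n + 2) → α) := by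
  refine Fin.antitone_iff_succ_le.2 fun k ↦ ?_
  cases k using Fin.lastCases with
  | last => rwa [Fin.succ_last, Fin.snoc_last, Fin.snoc_castSucc]
  | cast k =>
    rw [Fin.succ_castSucc, Fin.snoc_castSucc, Fin.snoc_castSucc]
    exact hq k.castSucc_le_succ

theorem exists_antitone_lift {α β : Type*} [Preorder α] [Preorder β] {f : α → β}
    (hf : Relation.Fibration (· ≤ ·) (· ≤ ·) f) {m n : ℕ} (hm : 0 < m) (hmn : m ≤ n)
    {p : Fin n → β} (hp : Antitone p) {q : Fin m → α} (hq : Antitone q)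
    (hqp : ∀ k, f (q k) = p (Fin.castLE hmn k)) :
    ∃ q' : Fin n → α, Antitone q' ∧ (∀ k, q' (Fin.castLE hmn k) = q k) ∧ ∀ k, f (q' k) = p k := by
  induction n, hmn using Nat.le_induction with
  | base => exact ⟨q, hq, fun _ ↦ rfl, hqp⟩
  | succ n hmn ih =>
    obtain ⟨r, hr, hrq, hrp⟩ := ih (hp.comp_monotone Fin.strictMono_castSucc.monotone) hqp
    obtain ⟨n, rfl⟩ := Nat.exists_eq_add_one_of_ne_zero (hm.trans_le hmn).ne'
    obtain ⟨a, har, hap⟩ := hf ((hp (Fin.castSucc_le_succ (Fin.last n))).trans_eq (hrp _).symm)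
    refine ⟨Fin.snoc r a, antitone_snoc hr har, fun k ↦ ?_, fun k ↦ ?_⟩
    · rw [← hrq]
      exact Fin.snoc_castSucc (α := fun _ ↦ α) a r (Fin.castLE hmn k)
    · cases k using Fin.lastCases with
      | last => rw [Fin.snoc_last, hap, Fin.succ_last]
      | cast k => rw [Fin.snoc_castSucc, hrp, Function.comp_apply]

namespace DiffRing

section MinimalPrimes

variable {Δ R : Type*} [CommRing R] [DiffRing Δ R]

theorem IsDiffIdeal.pow_mul_deriv_mem [Algebra ℚ R] {I : Ideal R} (hI : IsDiffIdeal Δ I) (i : Δ)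
    {x y : R} {n : ℕ} (h : x ^ (n + 1) * y ∈ I) : x ^ n * (deriv i x * (y * y)) ∈ I := by
  have hleibniz : y * deriv i (x ^ (n + 1) * y) - deriv i y * (x ^ (n + 1) * y) =
      ((n + 1 : ℕ) : R) * (x ^ n * (deriv i x * (y * y))) := by
    rw [Derivation.leibniz, Derivation.leibniz_pow]
    simp only [smul_eq_mul, nsmul_eq_mul, Nat.add_sub_cancel]
    ring
  have hunit : IsUnit ((n + 1 : ℕ) : R) := by
    rw [← map_natCast (algebraMap ℚ R)]
    exact (Nat.cast_ne_zero.2 n.succ_ne_zero).isUnit.map _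
  rw [← Ideal.unit_mul_mem_iff_mem I hunit, ← hleibniz]
  exact I.sub_mem (I.mul_mem_left y (hI i _ h)) (I.mul_mem_left (deriv i y) h)

theorem exists_pow_mul_mem_of_mem_minimalPrimes {I p : Ideal R} (hp : p ∈ I.minimalPrimes) {x : R}
    (hx : x ∈ p) : ∃ n : ℕ, ∃ y ∉ p, x ^ n * y ∈ I := by
  have := hp.1.1
  have hxp := Ideal.mem_map_of_mem (algebraMap R (Localization.AtPrime p)) hx
  rw [← IsLocalization.AtPrime.radical_map_of_mem_minimalPrimes _ p I hp] at hxp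
  obtain ⟨n, hn⟩ := hxp
  rw [← map_pow, IsLocalization.algebraMap_mem_map_algebraMap_iff p.primeCompl] at hn
  obtain ⟨y, hy, hxy⟩ := hn
  exact ⟨n, y, hy, mul_comm y (x ^ n) ▸ hxy⟩

theorem IsDiffIdeal.of_mem_minimalPrimes [Algebra ℚ R] {I p : Ideal R} (hI : IsDiffIdeal Δ I)
    (hp : p ∈ I.minimalPrimes) : IsDiffIdeal Δ p := by
  intro i x hx
  have := hp.1.1
  obtain ⟨n, y, hy, hxy⟩ := exists_pow_mul_mem_of_mem_minimalPrimes hp hx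
  by_contra hdx
  induction n generalizing y with
  | zero => exact hy (hp.1.2 (by rwa [pow_zero, one_mul] at hxy))
  | succ n ih =>
    exact ih _ (p.primeCompl.mul_mem hdx (p.primeCompl.mul_mem hy hy)) (hI.pow_mul_deriv_mem i hxy)

end MinimalPrimes

section Hom

variable {Δ A B : Type*} [CommRing A] [CommRing B] [DiffRing Δ A] [DiffRing Δ B] {f : A →+* B}

theorem IsDiffIdeal.map (hf : IsDiffHom Δ f) {I : Ideal A} (hI : IsDiffIdeal Δ I) :
    IsDiffIdeal Δ (I.map f) := by
  intro i x hx
  induction hx using Submodule.span_induction with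
  | mem x h =>
    obtain ⟨a, ha, rfl⟩ := h
    rw [← hf]
    exact Ideal.mem_map_of_mem f (hI i a ha)
  | zero => rw [map_zero]; exact zero_mem _
  | add x y _ _ hx hy => rw [map_add]; exact add_mem hx hy
  | smul a x h hx =>
    rw [smul_eq_mul, Derivation.leibniz]
    exact add_mem (Ideal.mul_mem_left _ _ hx) (Ideal.mul_mem_right _ _ h)

theorem IsPrimeDiff.comap (hf : IsDiffHom Δ f) {q : Ideal B} (hq : IsPrimeDiff Δ q) :
    IsPrimeDiff Δ (q.comap f) := by
  have := hq.1
  refine ⟨q.comap_isPrime f, fun i x hx ↦ ?_⟩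
  rw [Ideal.mem_comap, hf]
  exact hq.2 i _ hx

/-- The differential spectrum: the prime differential ideals, ordered by inclusion. -/
abbrev DiffSpec (Δ R : Type*) [CommRing R] [DiffRing Δ R] : Type _ :=
  {p : Ideal R // IsPrimeDiff Δ p}

/-- The map of differential spectra induced by a differential homomorphism, `q ↦ f⁻¹(q)`. -/
def DiffSpec.comap (hf : IsDiffHom Δ f) (q : DiffSpec Δ B) : DiffSpec Δ A :=
  ⟨q.1.comap f, q.2.comap hf⟩

theorem DiffSpec.fibration_comap_of_flat [Algebra ℚ B] [Algebra A B] [Module.Flat A B]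
    (hf : IsDiffHom Δ (algebraMap A B)) :
    Relation.Fibration (· ≤ ·) (· ≤ ·) (DiffSpec.comap hf) := by
  rintro ⟨q, hq⟩ ⟨p, hp⟩ hpq
  have := hp.1
  have := hq.1
  have : q.LiesOver (q.comap (algebraMap A B)) := ⟨rfl⟩
  obtain ⟨P, hPq, hPprime, hP⟩ :=
    Ideal.exists_ideal_le_liesOver_of_le (p := p) (q := q.comap (algebraMap A B)) q hpq
  have hpP : p.map (algebraMap A B) ≤ P := Ideal.map_le_iff_le_comap.2 hP.over.le
  obtain ⟨r, hr, hrP⟩ := Ideal.exists_minimalPrimes_le hpP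
  refine ⟨⟨r, hr.1.1, (hp.2.map hf).of_mem_minimalPrimes hr⟩, hrP.trans hPq, Subtype.ext ?_⟩
  exact le_antisymm ((Ideal.comap_mono hrP).trans hP.over.ge) (Ideal.map_le_iff_le_comap.1 hr.1.2)

theorem hasDiffGoingDown_of_fibration (hf : IsDiffHom Δ f)
    (hfib : Relation.Fibration (· ≤ ·) (· ≤ ·) (DiffSpec.comap hf)) : HasDiffGoingDown f hf := by
  intro n m hm hmn p q hp hpd hq hqd hqp
  let _ : DiffRing Δ f.range := range hf
  have hsub : IsDiffHom Δ f.range.subtype := fun _ _ ↦ rfl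
  have hrange : IsDiffHom Δ f.rangeRestrict := fun i a ↦ Subtype.ext (hf i a)
  have hfib' : Relation.Fibration (· ≤ ·) (· ≤ ·) (DiffSpec.comap hsub) := by
    rintro a b hba
    obtain ⟨a', ha', hab⟩ := hfib (a := a) (b := b.comap hrange) (Ideal.comap_mono hba)
    refine ⟨a', ha', Subtype.ext <|
      Ideal.comap_injective_of_surjective _ f.rangeRestrict_surjective ?_⟩
    exact congrArg Subtype.val hab
  obtain ⟨q', hq', hqq', hqp'⟩ := exists_antitone_lift hfib' hm hmn.le
    (p := fun k ↦ ⟨p k, hpd k⟩) hp (q := fun k ↦ ⟨q k, hqd k⟩) hq fun k ↦ Subtype.ext (hqp k)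
  exact ⟨fun k ↦ (q' k).1, hq', fun k ↦ (q' k).2, fun k ↦ congrArg Subtype.val (hqq' k),
    fun k ↦ congrArg Subtype.val (hqp' k)⟩

theorem hasDiffGoingDown_of_flat [Algebra ℚ B] [Algebra A B] [Module.Flat A B]
    (hf : IsDiffHom Δ (algebraMap A B)) : HasDiffGoingDown (algebraMap A B) hf :=
  hasDiffGoingDown_of_fibration hf (DiffSpec.fibration_comap_of_flat hf)

end Hom

end DiffRing

theorem exists_free_submodule_smul_mem (R M : Type*) [CommRing R] [IsDomain R] [AddCommGroup M]
    [Module R M] [Module.Finite R M] :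
    ∃ N : Submodule R M, Module.Free R N ∧ ∃ r : R, r ≠ 0 ∧ ∀ x, r • x ∈ N := by
  obtain ⟨t, ht⟩ := Module.finite_def.1 ‹Module.Finite R M›
  obtain ⟨s, hs, hmax⟩ := exists_maximal_linearIndepOn R (id : M → M)
  rw [Set.image_id] at hmax
  have hsmul (x : M) : ∃ a : R, a ≠ 0 ∧ a • x ∈ Submodule.span R s := by
    by_cases hx : x ∈ s
    · exact ⟨1, one_ne_zero, Submodule.smul_mem _ 1 (Submodule.subset_span hx)⟩
    · exact hmax x hx
  choose a ha0 ha using hsmul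
  have hfree : Module.Free R (Submodule.span R s) := by
    have hbasis := Module.Free.of_basis (Module.Basis.span hs)
    rwa [← Set.image_eq_range, Set.image_id] at hbasis
  refine ⟨Submodule.span R s, hfree, ∏ x ∈ t, a x,
    Finset.prod_ne_zero_iff.2 fun x _ ↦ ha0 x, fun y ↦ ?_⟩
  suffices hle : Submodule.span R (t : Set M) ≤
      (Submodule.span R s).comap (LinearMap.lsmul R M (∏ x ∈ t, a x)) from
    hle (ht ▸ Submodule.mem_top)
  refine Submodule.span_le.2 fun x hx ↦ ?_
  obtain ⟨c, hc⟩ := Finset.dvd_prod_of_mem a hx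
  rw [SetLike.mem_coe, Submodule.mem_comap, LinearMap.lsmul_apply, hc, mul_comm, mul_smul]
  exact Submodule.smul_mem _ c (ha x)

section Localization

variable {R : Type*} [CommRing R]

theorem isLocalizedModule_comp_subtype {M M' : Type*} [AddCommGroup M] [AddCommGroup M']
    [Module R M] [Module R M'] (S : Submonoid R) (f : M →ₗ[R] M') [IsLocalizedModule S f]
    {N : Submodule R M} (hN : ∀ x, ∃ s ∈ S, s • x ∈ N) :
    IsLocalizedModule S (f ∘ₗ N.subtype) where
  map_units := IsLocalizedModule.map_units f
  surj y := by
    obtain ⟨⟨x, s⟩, hxs⟩ := IsLocalizedModule.surj S f y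
    obtain ⟨t, ht, htx⟩ := hN x
    refine ⟨⟨⟨t • x, htx⟩, ⟨t, ht⟩ * s⟩, ?_⟩
    rw [mul_smul, hxs, LinearMap.comp_apply, Submodule.subtype_apply, map_smul, Submonoid.mk_smul]
  exists_of_eq h := by
    obtain ⟨c, hc⟩ := IsLocalizedModule.exists_of_eq (S := S) (f := f) h
    exact ⟨c, Subtype.ext hc⟩

theorem flat_of_isLocalizedModule {M M' : Type*} [AddCommGroup M] [AddCommGroup M']
    [Module R M] [Module R M'] [Module.Flat R M] (S : Submonoid R) (f : M →ₗ[R] M')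
    [IsLocalizedModule S f] : Module.Flat R M' :=
  have : Module.Flat R (LocalizedModule S M) := Module.Flat.trans R (Localization S) _
  Module.Flat.of_linearEquiv (IsLocalizedModule.iso S f).symm

variable {B : Type*} [CommRing B] [Algebra R B]

theorem flat_localizationAway_of_pow_smul_mem {N : Submodule R B} [Module.Flat R N] {r : R}
    (hN : ∀ x : B, ∃ k : ℕ, r ^ k • x ∈ N) :
    Module.Flat R (Localization.Away (algebraMap R B r)) := by
  have : IsLocalizedModule (Submonoid.powers r)
      (IsScalarTower.toAlgHom R B (Localization.Away (algebraMap R B r))).toLinearMap := by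
    rw [isLocalizedModule_iff_isLocalization, Algebra.algebraMapSubmonoid_powers]
    infer_instance
  have := isLocalizedModule_comp_subtype (Submonoid.powers r)
    (IsScalarTower.toAlgHom R B (Localization.Away (algebraMap R B r))).toLinearMap
    (N := N) fun x ↦ (hN x).elim fun k hk ↦ ⟨r ^ k, ⟨k, rfl⟩, hk⟩
  exact flat_of_isLocalizedModule (Submonoid.powers r)
    ((IsScalarTower.toAlgHom R B (Localization.Away (algebraMap R B r))).toLinearMap ∘ₗ N.subtype)

/-- The contraction to `B` of the localization `E_r` of a subalgebra `E` at an element `r` of the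
base ring, used to express finite generation of `B_r` without leaving `B`. -/
def powSaturation (r : R) (E : Subalgebra R B) : Subalgebra R B where
  carrier := {x | ∃ k : ℕ, r ^ k • x ∈ E}
  mul_mem' := by
    rintro x y ⟨k, hk⟩ ⟨l, hl⟩
    refine ⟨k + l, ?_⟩
    rw [pow_add, ← smul_mul_smul_comm]
    exact mul_mem hk hl
  add_mem' := by
    rintro x y ⟨k, hk⟩ ⟨l, hl⟩
    refine ⟨k + l, ?_⟩
    rw [smul_add]
    nth_rw 1 [add_comm k l]
    rw [pow_add, pow_add, mul_smul, mul_smul]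
    exact add_mem (E.smul_mem hk _) (E.smul_mem hl _)
  algebraMap_mem' a := ⟨0, by rw [pow_zero, one_smul]; exact E.algebraMap_mem a⟩

theorem le_powSaturation (r : R) (E : Subalgebra R B) : E ≤ powSaturation r E :=
  fun _ hx ↦ ⟨0, by rwa [pow_zero, one_smul]⟩

theorem powSaturation_le_powSaturation_mul {r s : R} {E F : Subalgebra R B}
    (h : E ≤ powSaturation s F) : powSaturation r E ≤ powSaturation (r * s) F := by
  rintro x ⟨k, hk⟩
  obtain ⟨l, hl⟩ := h hk
  refine ⟨l + k, ?_⟩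
  have hpow : (r * s) ^ (l + k) = r ^ l * s ^ k * (s ^ l * r ^ k) := by ring
  rw [hpow, mul_smul, mul_smul (s ^ l)]
  exact F.smul_mem hl _

theorem mem_powSaturation_of_smul_mem {r : R} {E : Subalgebra R B} {x : B}
    (h : r • x ∈ powSaturation r E) : x ∈ powSaturation r E := by
  obtain ⟨k, hk⟩ := h
  exact ⟨k + 1, by rwa [pow_succ, mul_smul]⟩

theorem exists_flat_localizationAway_of_isAlgebraic [IsDomain R] [Algebra.IsAlgebraic R B]
    {t : Set B} (ht : t.Finite) {r : R} (hr : r ≠ 0)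
    (htop : powSaturation r (Algebra.adjoin R t) = ⊤) :
    ∃ s : R, s ≠ 0 ∧ Module.Flat R (Localization.Away (algebraMap R B s)) := by
  obtain ⟨a, ha, hint⟩ := Algebra.IsAlgebraic.exists_integral_multiples R ht.toFinset
  let E := Algebra.adjoin R ((a • ·) '' t)
  have : Module.Finite R E := Algebra.finite_adjoin_of_finite_of_isIntegral (ht.image _) <| by
    rintro _ ⟨x, hx, rfl⟩
    exact hint x (ht.mem_toFinset.2 hx)
  obtain ⟨N, hN, b, hb, hbN⟩ := exists_free_submodule_smul_mem R E
  have hle : Algebra.adjoin R t ≤ powSaturation a E := Algebra.adjoin_le fun x hx ↦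
    mem_powSaturation_of_smul_mem <| le_powSaturation a E <|
      Algebra.subset_adjoin (Set.mem_image_of_mem _ hx)
  have hN' : Module.Flat R (N.map E.val.toLinearMap) :=
    Module.Flat.of_linearEquiv
      (N.equivMapOfInjective E.val.toLinearMap Subtype.val_injective).symm
  refine ⟨r * a * b, mul_ne_zero (mul_ne_zero hr ha) hb,
    flat_localizationAway_of_pow_smul_mem (N := N.map E.val.toLinearMap) fun x ↦ ?_⟩
  obtain ⟨k, hk⟩ : x ∈ powSaturation (r * a) E :=
    powSaturation_le_powSaturation_mul hle (htop ▸ Algebra.mem_top)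
  have hpow : (r * a * b) ^ (k + 1) = b ^ k * (r * a) * (b * (r * a) ^ k) := by ring
  refine ⟨k + 1, ?_⟩
  rw [hpow, mul_smul, mul_smul b]
  exact Submodule.smul_mem _ _ ⟨_, hbN ⟨_, hk⟩, rfl⟩

end Localization

section Triangular

variable {A B I : Type*} [CommRing A] [CommRing B] [Algebra A B] {u : I → B}

/-- The subalgebra generated by the members of a family that come strictly before the index `v`.
With `u` the family of all derivatives of the differential generators, this is the algebra over
which the derivative `u v` is tested for algebraicity. -/
def adjoinBelow (A : Type*) {B I : Type*} [CommRing A] [CommRing B] [Algebra A B] [Preorder I]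
    (u : I → B) (v : I) : Subalgebra A B :=
  Algebra.adjoin A (u '' Set.Iio v)

section Preorder

variable [Preorder I]

theorem mem_adjoinBelow {v w : I} (h : w < v) : u w ∈ adjoinBelow A u v :=
  Algebra.subset_adjoin ⟨w, h, rfl⟩

theorem adjoinBelow_le {v : I} {E : Subalgebra A B} (h : ∀ w < v, u w ∈ E) :
    adjoinBelow A u v ≤ E :=
  Algebra.adjoin_le (Set.image_subset_iff.2 h)

theorem adjoinBelow_mono : Monotone (adjoinBelow A u) := fun _ _ h ↦
  adjoinBelow_le fun _ hw ↦ mem_adjoinBelow (hw.trans_le h)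

theorem isAlgebraic_adjoin_image [WellFoundedLT I] [IsDomain B] {N : Set I}
    (h : ∀ v ∉ N, IsAlgebraic (adjoinBelow A u v) (u v)) (v : I) :
    IsAlgebraic (Algebra.adjoin A (u '' N)) (u v) := by
  induction v using WellFoundedLT.induction with
  | ind v ih =>
    by_cases hv : v ∈ N
    · exact isAlgebraic_algebraMap
        (⟨u v, Algebra.subset_adjoin ⟨v, hv, rfl⟩⟩ : Algebra.adjoin A (u '' N))
    · refine IsAlgebraic.adjoin_of_forall_isAlgebraic ?_ (h v hv)
      rintro _ ⟨⟨w, hw, rfl⟩, -⟩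
      exact ih w hw

end Preorder

theorem algebraicIndependent_of_transcendental_adjoinBelow [LinearOrder I]
    (hinj : Function.Injective (algebraMap A B))
    (h : ∀ v, Transcendental (adjoinBelow A u v) (u v)) : AlgebraicIndependent A u := by
  classical
  refine algebraicIndependent_of_finite_type fun t ht ↦ ?_
  lift t to Finset I using ht
  induction t using Finset.induction_on_max with
  | empty =>
    rw [Finset.coe_empty]
    exact algebraicIndependent_empty_type_iff.2 hinj
  | insert v t htv ih =>
    rw [Finset.coe_insert]
    exact AlgebraicIndepOn.insert ih <| (h v).of_tower_top_of_subalgebra_le <|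
      Algebra.adjoin_mono (Set.image_mono htv)

theorem algebraicIndepOn_of_transcendental_adjoinBelow [LinearOrder I]
    (hinj : Function.Injective (algebraMap A B)) {N : Set I}
    (h : ∀ v ∈ N, Transcendental (adjoinBelow A u v) (u v)) : AlgebraicIndepOn A u N := by
  refine algebraicIndependent_of_transcendental_adjoinBelow hinj fun v ↦ ?_
  have hle : adjoinBelow A (fun v : N ↦ u v) v ≤ adjoinBelow A u v :=
    adjoinBelow_le fun w hw ↦ mem_adjoinBelow (v := (v : I)) hw
  exact (h v v.2).of_tower_top_of_subalgebra_le hle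

theorem flat_adjoin_image {N : Set I} (h : AlgebraicIndepOn A u N) :
    Module.Flat A (Algebra.adjoin A (u '' N)) :=
  Module.Flat.of_linearEquiv h.aevalEquiv.symm.toLinearEquiv

theorem exists_powSaturation_adjoin_eq_top [Preorder I] [WellFoundedLT I] [IsDomain B]
    [Algebra.IsAlgebraic A B] (hu : Algebra.adjoin A (Set.range u) = ⊤) {V : Set I}
    (hV : V.Finite) {T : Set B} (hT : T.Finite) (hT0 : 0 ∉ T)
    (h : ∀ v ∉ V, ∃ S ∈ T, S * u v ∈ adjoinBelow A u v) :
    ∃ r : A, r ≠ 0 ∧ ∃ t : Set B, t.Finite ∧ powSaturation r (Algebra.adjoin A t) = ⊤ := by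
  lift T to Finset B using hT
  obtain ⟨r, hr, hdvd⟩ := (Algebra.IsAlgebraic.isAlgebraic (R := A) (∏ S ∈ T, S)).exists_nonzero_dvd
    (mem_nonZeroDivisors_of_ne_zero (Finset.prod_ne_zero_iff.2 fun S hS h0 ↦ hT0 (h0 ▸ hS)))
  have hinv : ∀ S ∈ T, ∃ c, algebraMap A B r = S * c := fun S hS ↦
    (Finset.dvd_prod_of_mem _ hS).trans hdvd
  choose! c hc using hinv
  let t := u '' V ∪ c '' T
  have hut (v : I) : u v ∈ powSaturation r (Algebra.adjoin A t) := by
    induction v using WellFoundedLT.induction with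
    | ind v ih =>
      by_cases hv : v ∈ V
      · exact le_powSaturation r _ (Algebra.subset_adjoin (Or.inl ⟨v, hv, rfl⟩))
      · obtain ⟨S, hS, hSv⟩ := h v hv
        have hcS : c S ∈ powSaturation r (Algebra.adjoin A t) :=
          le_powSaturation r _ (Algebra.subset_adjoin (Or.inr ⟨S, hS, rfl⟩))
        refine mem_powSaturation_of_smul_mem ?_
        have hmul : r • u v = c S * (S * u v) := by
          rw [Algebra.smul_def, hc S hS]
          ring
        rw [hmul]
        exact mul_mem hcS (adjoinBelow_le ih hSv)
  refine ⟨r, hr, t, (hV.image u).union (T.finite_toSet.image c), top_unique ?_⟩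
  rw [← hu]
  exact Algebra.adjoin_le (Set.range_subset_iff.2 hut)

theorem exists_flat_localizationAway_trans {P : Type*} [CommRing P] [Algebra A P] [Algebra P B]
    [IsScalarTower A P B] [FaithfulSMul P B] [Module.Flat A P]
    (h : ∃ s : P, s ≠ 0 ∧ Module.Flat P (Localization.Away (algebraMap P B s))) :
    ∃ s : B, s ≠ 0 ∧ Module.Flat A (Localization.Away s) := by
  obtain ⟨s, hs, hflat⟩ := h
  exact ⟨algebraMap P B s, (map_ne_zero_iff _ (FaithfulSMul.algebraMap_injective P B)).2 hs,
    Module.Flat.trans A P _⟩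

theorem exists_flat_localizationAway_of_adjoinBelow [LinearOrder I] [WellFoundedLT I] [IsDomain B]
    (hinj : Function.Injective (algebraMap A B)) (hu : Algebra.adjoin A (Set.range u) = ⊤)
    {V : Set I} (hV : V.Finite) {T : Set B} (hT : T.Finite) (hT0 : 0 ∉ T)
    (h : ∀ v ∉ V, IsAlgebraic (adjoinBelow A u v) (u v) →
      ∃ S ∈ T, S * u v ∈ adjoinBelow A u v) :
    ∃ s : B, s ≠ 0 ∧ Module.Flat A (Localization.Away s) := by
  let N : Set I := {v | Transcendental (adjoinBelow A u v) (u v)}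
  let P := Algebra.adjoin A (u '' N)
  have hflat : Module.Flat A P :=
    flat_adjoin_image (algebraicIndepOn_of_transcendental_adjoinBelow hinj fun _ hv ↦ hv)
  have hle {s : Set B} : Algebra.adjoin A s ≤ (Algebra.adjoin P s).restrictScalars A :=
    Algebra.adjoin_le Algebra.subset_adjoin
  have huP : Algebra.adjoin P (Set.range u) = ⊤ :=
    top_unique fun x _ ↦ hle (hu ▸ Algebra.mem_top)
  have hPalg : Algebra.IsAlgebraic P B :=
    ⟨fun x ↦ Algebra.isAlgebraic_adjoin_iff.2
      (Set.forall_mem_range.2 (isAlgebraic_adjoin_image fun v hv ↦ not_not.1 hv)) x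
      (huP ▸ Algebra.mem_top)⟩
  have hquasilinear (v : I) (hv : v ∉ V) : ∃ S ∈ insert 1 T, S * u v ∈ adjoinBelow P u v := by
    by_cases hvN : v ∈ N
    · refine ⟨1, Set.mem_insert 1 T, ?_⟩
      rw [one_mul]
      exact (adjoinBelow P u v).algebraMap_mem (⟨u v, Algebra.subset_adjoin ⟨v, hvN, rfl⟩⟩ : P)
    · obtain ⟨S, hS, hSv⟩ := h v hv (not_not.1 hvN)
      exact ⟨S, Set.mem_insert_of_mem 1 hS, hle hSv⟩
  obtain ⟨r, hr, t, ht, htop⟩ := exists_powSaturation_adjoin_eq_top huP hV (hT.insert 1)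
    (by simp [hT0]) hquasilinear
  exact exists_flat_localizationAway_trans (exists_flat_localizationAway_of_isAlgebraic ht hr htop)

end Triangular

theorem finsupp_induction_single_one_add {σ : Type*} {motive : (σ →₀ ℕ) → Prop}
    (zero : motive 0)
    (single_one_add : ∀ i θ, motive θ → motive (Finsupp.single i 1 + θ)) (θ : σ →₀ ℕ) :
    motive θ := by
  induction θ using Finsupp.induction with
  | zero => exact zero
  | single_add i n f _ _ hf =>
    clear * - hf single_one_add
    induction n with
    | zero => rwa [Finsupp.single_zero, zero_add]
    | succ n ih =>
      rw [add_comm n 1, Finsupp.single_add, add_assoc]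
      exact single_one_add i _ ih

/-- A ranking in the sense of Ritt and Kolchin, for a monoid `M` of derivative operators acting on
the index set `I` of the derivatives of a family of differential indeterminates: the order on `I`
is compatible with derivation, and every proper derivative comes after the derivative it is
derived from. -/
class IsRanking (M I : Type*) [AddMonoid M] [AddAction M I] [Preorder I] : Prop where
  vadd_strictMono (θ : M) : StrictMono fun v : I ↦ θ +ᵥ v
  lt_vadd {θ : M} (hθ : θ ≠ 0) (v : I) : v < θ +ᵥ v

theorem IsRanking.lt_single_vadd {σ I : Type*} [AddAction (σ →₀ ℕ) I] [Preorder I]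
    [IsRanking (σ →₀ ℕ) I] (i : σ) (v : I) : v < Finsupp.single i 1 +ᵥ v :=
  IsRanking.lt_vadd (Finsupp.single_ne_zero.2 one_ne_zero) v

theorem exists_aeval_eq_zero_aeval_derivative_ne_zero {C B : Type*} [CommRing C] [CommRing B]
    [Algebra C B] [IsDomain B] [CharZero B] [FaithfulSMul C B] {x : B} (hx : IsAlgebraic C x) :
    ∃ F : C[X], aeval x F = 0 ∧ aeval x (derivative F) ≠ 0 := by
  have hinj := FaithfulSMul.algebraMap_injective C B
  have : IsDomain C := hinj.isDomain
  have : CharZero C := (algebraMap C B).charZero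
  obtain ⟨F, ⟨hF, hFx⟩, hmin⟩ := exists_minimalFor_of_wellFoundedLT
    (fun F : C[X] ↦ F ≠ 0 ∧ aeval x F = 0) natDegree hx
  have hdeg : F.natDegree ≠ 0 := fun h0 ↦ hF <| by
    rw [eq_C_of_natDegree_eq_zero h0, aeval_C, map_eq_zero_iff _ hinj] at hFx
    rw [eq_C_of_natDegree_eq_zero h0, hFx, C_0]
  refine ⟨F, hFx, fun hF'x ↦ ?_⟩
  have hF' : derivative F ≠ 0 := fun h ↦ hdeg (derivative_eq_zero.1 h)
  exact (natDegree_derivative_lt hdeg).not_ge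
    (hmin ⟨hF', hF'x⟩ (natDegree_derivative_lt hdeg).le)

theorem aeval_mem_of_le {A B : Type*} [CommRing A] [CommRing B] [Algebra A B] {C E : Subalgebra A B}
    (hCE : C ≤ E) {x : B} (hx : x ∈ E) (F : C[X]) : aeval x F ∈ E := by
  rw [aeval_eq_sum_range]
  exact sum_mem fun n _ ↦ mul_mem (hCE (F.coeff n).2) (pow_mem hx n)

namespace DiffRing

variable {Δ A B I : Type*} [CommRing A] [CommRing B] [Algebra A B] [DiffRing Δ B]

theorem deriv_aeval_sub_mem {i : Δ} {C E : Subalgebra A B} (hC : ∀ c ∈ C, deriv i c ∈ E) {x : B}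
    (hx : x ∈ E) (F : C[X]) :
    deriv i (aeval x F) - aeval x (derivative F) * deriv i x ∈ E := by
  induction F using Polynomial.induction_on' with
  | add F G hF hG =>
    have hsum : deriv i (aeval x (F + G)) - aeval x (derivative (F + G)) * deriv i x =
        (deriv i (aeval x F) - aeval x (derivative F) * deriv i x) +
          (deriv i (aeval x G) - aeval x (derivative G) * deriv i x) := by
      simp only [map_add]
      ring
    rw [hsum]
    exact add_mem hF hG
  | monomial n c =>
    have hmonomial : deriv i (aeval x (monomial n c)) -
        aeval x (derivative (monomial n c)) * deriv i x = x ^ n * deriv i (c : B) := by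
      rw [derivative_monomial, aeval_monomial, aeval_monomial, Derivation.leibniz,
        Derivation.leibniz_pow, map_mul, map_natCast]
      simp only [Subalgebra.algebraMap_def, Algebra.algebraMap_self, RingHom.id_apply,
        smul_eq_mul, nsmul_eq_mul]
      ring
    rw [hmonomial]
    exact mul_mem (pow_mem hx n) (hC c c.2)

variable [DiffRing Δ A]

theorem deriv_mem_of_mem_adjoin (hf : IsDiffHom Δ (algebraMap A B)) {i : Δ} {s : Set B}
    {E : Subalgebra A B} (hs : s ⊆ E) (hds : ∀ x ∈ s, deriv i x ∈ E) {x : B}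
    (hx : x ∈ Algebra.adjoin A s) : deriv i x ∈ E := by
  have hle : Algebra.adjoin A s ≤ E := Algebra.adjoin_le hs
  induction hx using Algebra.adjoin_induction with
  | mem x hx => exact hds x hx
  | algebraMap a => rw [← hf]; exact E.algebraMap_mem _
  | add x y _ _ hx hy => rw [map_add]; exact add_mem hx hy
  | mul x y hx' hy' hx hy =>
    rw [Derivation.leibniz]
    exact add_mem (mul_mem (hle hx') hy) (mul_mem (hle hy') hx)

section Ranking

variable [Preorder I] [AddAction (Δ →₀ ℕ) I] [IsRanking (Δ →₀ ℕ) I] {u : I → B}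

theorem deriv_mem_adjoinBelow (hf : IsDiffHom Δ (algebraMap A B))
    (hu : ∀ (i : Δ) (v : I), deriv i (u v) = u (Finsupp.single i 1 +ᵥ v)) {i : Δ} {v : I} {x : B}
    (hx : x ∈ adjoinBelow A u v) : deriv i x ∈ adjoinBelow A u (Finsupp.single i 1 +ᵥ v) := by
  refine deriv_mem_of_mem_adjoin hf ?_ ?_ hx
  · rintro _ ⟨w, hw, rfl⟩
    exact mem_adjoinBelow (hw.trans (IsRanking.lt_single_vadd i v))
  · rintro _ ⟨w, hw, rfl⟩
    rw [hu]
    exact mem_adjoinBelow (IsRanking.vadd_strictMono (Finsupp.single i 1) hw)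

theorem exists_separant_mul_mem_adjoinBelow [CharZero B] [IsDomain B]
    (hf : IsDiffHom Δ (algebraMap A B))
    (hu : ∀ (i : Δ) (v : I), deriv i (u v) = u (Finsupp.single i 1 +ᵥ v)) {w : I}
    (hw : IsAlgebraic (adjoinBelow A u w) (u w)) :
    ∃ S : B, S ≠ 0 ∧
      ∀ θ : Δ →₀ ℕ, θ ≠ 0 → S * u (θ +ᵥ w) ∈ adjoinBelow A u (θ +ᵥ w) := by
  -- Differentiating `F(u w) = 0` gives `S * δ (u w) + (lower terms) = 0`, with `S` the separant.
  obtain ⟨F, hFw, hF'w⟩ := exists_aeval_eq_zero_aeval_derivative_ne_zero hw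
  refine ⟨aeval (u w) (derivative F), hF'w, fun θ hθ ↦ ?_⟩
  have hSmem {v : I} (hv : w < v) : aeval (u w) (derivative F) ∈ adjoinBelow A u v :=
    aeval_mem_of_le (adjoinBelow_mono hv.le) (mem_adjoinBelow hv) _
  induction θ using finsupp_induction_single_one_add with
  | zero => exact absurd rfl hθ
  | single_one_add i θ ih =>
    obtain rfl | hθ := eq_or_ne θ 0
    · have hwi := IsRanking.lt_single_vadd i w
      have hmem := deriv_aeval_sub_mem (i := i) (E := adjoinBelow A u (Finsupp.single i 1 +ᵥ w))
        (fun c hc ↦ deriv_mem_adjoinBelow hf hu hc) (mem_adjoinBelow hwi) F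
      rwa [hFw, map_zero, zero_sub, neg_mem_iff, hu, ← add_zero (Finsupp.single i 1)] at hmem
    · have hwθ : w < θ +ᵥ w := IsRanking.lt_vadd hθ w
      have hmem := deriv_mem_adjoinBelow (i := i) hf hu (ih hθ)
      rw [Derivation.leibniz, smul_eq_mul, smul_eq_mul, hu] at hmem
      rw [add_vadd]
      exact (add_mem_cancel_right (mul_mem (mem_adjoinBelow (IsRanking.lt_single_vadd i (θ +ᵥ w)))
        (deriv_mem_adjoinBelow hf hu (hSmem hwθ)))).1 hmem

end Ranking

end DiffRing

theorem exists_finite_subset_forall_mem_eq_vadd {M I : Type*} [AddCommMonoid M] [PartialOrder M]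
    [CanonicallyOrderedAdd M] [WellQuasiOrderedLE M] [AddAction M I] {G : Set I} (hG : G.Finite)
    (hMG : ∀ v, ∃ θ : M, ∃ g ∈ G, θ +ᵥ g = v) (X : Set I) :
    ∃ V ⊆ X, V.Finite ∧ ∀ v ∈ X, ∃ w ∈ V, ∃ θ : M, θ +ᵥ w = v := by
  let minimalAt (g : I) : Set M := {θ | Minimal (fun η ↦ η +ᵥ g ∈ X) θ}
  have hfin (g : I) : (minimalAt g).Finite :=
    WellQuasiOrderedLE.finite_of_isAntichain (setOfPred_minimal_antichain _)
  refine ⟨⋃ g ∈ G, (· +ᵥ g) '' minimalAt g, ?_, hG.biUnion fun g _ ↦ (hfin g).image _, ?_⟩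
  · simp only [Set.iUnion_subset_iff, Set.image_subset_iff]
    exact fun g _ θ (hθ : Minimal _ θ) ↦ hθ.prop
  · intro v hv
    obtain ⟨θ, g, hg, rfl⟩ := hMG v
    obtain ⟨η, hηθ, hη⟩ := exists_minimal_le_of_wellFoundedLT (fun η ↦ η +ᵥ g ∈ X) θ hv
    obtain ⟨ζ, rfl⟩ := le_iff_exists_add'.1 hηθ
    exact ⟨η +ᵥ g, Set.mem_biUnion hg (Set.mem_image_of_mem _ hη), ζ, (add_vadd ζ η g).symm⟩

section MonomialOrder

variable {σ ι : Type*} (m : MonomialOrder σ)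

/-- The action of the derivative operators on the derivatives `θ u_j` of a family of differential
indeterminates, for the ranking that compares first the multi-orders `θ` by `m` and then the
indices `j`. -/
noncomputable instance synLexAddAction : AddAction (σ →₀ ℕ) (m.syn ×ₗ ι) where
  vadd θ v := toLex (m.toSyn θ + (ofLex v).1, (ofLex v).2)
  zero_vadd v := by
    change toLex (m.toSyn 0 + (ofLex v).1, (ofLex v).2) = v
    rw [map_zero, zero_add]
    rfl
  add_vadd θ η v := by
    change toLex (m.toSyn (θ + η) + (ofLex v).1, (ofLex v).2) =
      toLex (m.toSyn θ + (m.toSyn η + (ofLex v).1), (ofLex v).2)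
    rw [map_add, add_assoc]

theorem synLex_vadd_def (θ : σ →₀ ℕ) (v : m.syn ×ₗ ι) :
    θ +ᵥ v = toLex (m.toSyn θ + (ofLex v).1, (ofLex v).2) :=
  rfl

instance isRanking_synLex [Preorder ι] : IsRanking (σ →₀ ℕ) (m.syn ×ₗ ι) where
  vadd_strictMono θ v w h := by
    rw [Prod.Lex.lt_iff] at h ⊢
    exact h.imp (add_lt_add_right · _) (And.imp_left (congrArg (m.toSyn θ + ·)))
  lt_vadd {θ} hθ v := Prod.Lex.lt_iff.2 <| Or.inl <| lt_add_of_pos_left _ <| by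
    rwa [m.toSyn_lt_iff_ne_zero, ne_eq, m.toSyn_eq_zero_iff]

end MonomialOrder

namespace DiffRing

section IterDeriv

variable {Δ B : Type*} [CommRing B] [DiffRing Δ B]

instance deriv_leftCommutative : LeftCommutative fun (i : Δ) (b : B) ↦ deriv i b :=
  ⟨deriv_comm⟩

/-- The derivative of `b` of multi-order `θ`, that is, `b` with each derivation `i` applied `θ i`
times. As the derivations commute, it does not depend on an order on `Δ`. -/
noncomputable def iterDeriv (θ : Δ →₀ ℕ) (b : B) : B :=
  (Finsupp.toMultiset θ).foldr (fun i x ↦ deriv i x) b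

theorem iterDeriv_zero (b : B) : iterDeriv (0 : Δ →₀ ℕ) b = b := by
  rw [iterDeriv, map_zero, Multiset.foldr_zero]

theorem iterDeriv_single_one_add (i : Δ) (θ : Δ →₀ ℕ) (b : B) :
    iterDeriv (Finsupp.single i 1 + θ) b = deriv i (iterDeriv θ b) := by
  rw [iterDeriv, map_add, Finsupp.toMultiset_single, one_smul, Multiset.singleton_add,
    Multiset.foldr_cons, iterDeriv]

end IterDeriv

variable {Δ A B I : Type*} [CommRing A] [CommRing B] [Algebra A B] [DiffRing Δ A] [DiffRing Δ B]

theorem exists_flat_localizationAway_of_ranking [CharZero B] [IsDomain B] [Finite Δ]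
    [LinearOrder I] [WellFoundedLT I] [AddAction (Δ →₀ ℕ) I] [IsRanking (Δ →₀ ℕ) I]
    (hinj : Function.Injective (algebraMap A B)) (hf : IsDiffHom Δ (algebraMap A B)) {u : I → B}
    (hu : ∀ (i : Δ) (v : I), deriv i (u v) = u (Finsupp.single i 1 +ᵥ v))
    (hgen : Algebra.adjoin A (Set.range u) = ⊤) {G : Set I} (hG : G.Finite)
    (hI : ∀ v, ∃ θ : Δ →₀ ℕ, ∃ g ∈ G, θ +ᵥ g = v) :
    ∃ s : B, s ≠ 0 ∧ Module.Flat A (Localization.Away s) := by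
  obtain ⟨V, hVsub, hV, hVgen⟩ := exists_finite_subset_forall_mem_eq_vadd hG hI
    {v | IsAlgebraic (adjoinBelow A u v) (u v)}
  choose! S hS0 hS using fun w (hw : w ∈ V) ↦ exists_separant_mul_mem_adjoinBelow hf hu (hVsub hw)
  refine exists_flat_localizationAway_of_adjoinBelow hinj hgen hV (hV.image S) ?_ ?_
  · rintro ⟨w, hw, hw0⟩
    exact hS0 w hw hw0
  · intro v hv hvalg
    obtain ⟨w, hw, θ, rfl⟩ := hVgen v hvalg
    have hθ : θ ≠ 0 := by
      rintro rfl
      exact hv (by rwa [zero_vadd])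
    exact ⟨S w, Set.mem_image_of_mem S hw, hS w hw θ hθ⟩

theorem exists_flat_localizationAway [Finite Δ] [CharZero B] [IsDomain B]
    (hinj : Function.Injective (algebraMap A B)) (hf : IsDiffHom Δ (algebraMap A B))
    (hfg : DiffFiniteType Δ A B) : ∃ s : B, s ≠ 0 ∧ Module.Flat A (Localization.Away s) := by
  obtain ⟨t, ht⟩ := hfg
  let _ : LinearOrder Δ := LinearOrder.lift' (Finite.equivFin Δ) (Equiv.injective _)
  let _ : LinearOrder t := LinearOrder.lift' t.equivFin t.equivFin.injective
  let m : MonomialOrder Δ := MonomialOrder.lex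
  let u (v : m.syn ×ₗ t) : B := iterDeriv (m.toSyn.symm (ofLex v).1) ((ofLex v).2 : B)
  have hu (i : Δ) (v : m.syn ×ₗ t) : deriv i (u v) = u (Finsupp.single i 1 +ᵥ v) := by
    simp only [u, synLex_vadd_def, ofLex_toLex, map_add, AddEquiv.symm_apply_apply,
      iterDeriv_single_one_add]
  have hgen : Algebra.adjoin A (Set.range u) = ⊤ := by
    refine ht _ (fun i x hx ↦ deriv_mem_of_mem_adjoin hf Algebra.subset_adjoin ?_ hx) ?_
    · rintro _ ⟨v, rfl⟩
      exact Algebra.subset_adjoin ⟨Finsupp.single i 1 +ᵥ v, (hu i v).symm⟩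
    · intro x hx
      refine Algebra.subset_adjoin ⟨toLex (0, ⟨x, hx⟩), ?_⟩
      simp only [u, ofLex_toLex, map_zero, iterDeriv_zero]
  refine exists_flat_localizationAway_of_ranking hinj hf hu hgen
    (Set.finite_range fun x : t ↦ (toLex (0, x) : m.syn ×ₗ t)) fun v ↦
      ⟨m.toSyn.symm (ofLex v).1, _, ⟨(ofLex v).2, rfl⟩, ?_⟩
  simp only [synLex_vadd_def, ofLex_toLex, AddEquiv.apply_symm_apply, add_zero, Prod.mk.eta,
    toLex_ofLex]

end DiffRing

theorem mainTheorem1_general {Δ : Type*} [Finite Δ] {A B : Type*} [CommRing A] [CommRing B]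
    [Algebra ℚ B] [DiffRing Δ A] [DiffRing Δ B] [IsDomain B] [Algebra A B]
    (hinj : Function.Injective (algebraMap A B)) (hdiff : DiffRing.IsDiffHom Δ (algebraMap A B))
    (hfg : DiffRing.DiffFiniteType Δ A B) :
    ∃ s : B, s ≠ 0 ∧ Function.Injective (algebraMap A (Localization.Away s)) ∧
      DiffRing.HasDiffGoingDown (Δ := Δ) (algebraMap A (Localization.Away s))
        (DiffRing.isDiffHom_away s hdiff) := by
  have : CharZero B := algebraRat.charZero B
  obtain ⟨s, hs, hflat⟩ := DiffRing.exists_flat_localizationAway hinj hdiff hfg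
  refine ⟨s, hs, ?_, DiffRing.hasDiffGoingDown_of_flat _⟩
  rw [IsScalarTower.algebraMap_eq A B]
  exact (IsLocalization.injective (Localization.Away s)
    (powers_le_nonZeroDivisors_of_noZeroDivisors hs)).comp hinj

theorem mainTheorem1 {Δ : Type*} [Finite Δ]
    {A B : Type*} [CommRing A] [CommRing B] [Algebra ℚ A] [Algebra ℚ B]
    [DiffRing Δ A] [DiffRing Δ B] [IsDomain B] [Algebra A B]
    (hinj : Function.Injective (algebraMap A B))
    (hdiff : DiffRing.IsDiffHom Δ (algebraMap A B))
    (hfg : DiffRing.DiffFiniteType Δ A B) :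
    ∃ s : B, s ≠ 0 ∧ Function.Injective (algebraMap A (Localization.Away s)) ∧
      DiffRing.HasDiffGoingDown (Δ := Δ) (algebraMap A (Localization.Away s))
        (DiffRing.isDiffHom_away s hdiff) :=
  mainTheorem1_general hinj hdiff hfg
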